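/- Let $G$ be a compact Hausdorff topological group. A $G$-space is a topological space with a continuous action of $G$, a $G$-subset is a $G$-invariant subset (viewed as a $G$-space with the restricted action), and a $G$-map is a continuous equivariant map. Let $X$ be a metrizable $G$-space and $A\subset X$ a $G$-subset. The pair $(X,A)$ is called a $G$-ANR-pair if for every metrizable $G$-space $Z$, every closed $G$-subset $B\subset Z$ and every $G$-map $f:B\to X$, there are a $G$-invariant neighborhood $U$ of $B$ in $Z$ and a $G$-map $F:U\to X$ with $F|_B=f$ and $F(U\setminus B)\subset A$; it is called a $G$-AR-pair if one can always take $U=Z$. A $G$-space $Y$ is called $G$-contractible if there are a point $c\in Y$ and a continuous map $F:Y\times[0,1]\to Y$ such that $F(gy,t)=gF(y,t)$, $F(y,0)=y$ and $F(y,1)=c$ for all $g\in G$, $y\in Y$, $t\in[0,1]$ (in particular $Y\neq\emptyset$). **Proposition.** Let $G$ be a compact Hausdorff topological group and let $(X,A)$ be a $G$-ANR-pair. Then $(X,A)$ is a $G$-AR-pair if and only if $A$ is $G$-contractible. -/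

import Mathlib

open Topology unitInterval

universe w v u

/-- `(X, A)` is a `G`-ANR-pair. Here `X` is a metrizable `G`-space, and `G`-subsets (invariant
subsets) are encoded as `SubMulAction`s. Every `G`-map `f : B → X` from a closed `G`-subset `B` of
a metrizable `G`-space `Z` extends to a `G`-map `F : U → X` on some `G`-neighborhood `U` of `B`,
in such a way that `F (U \ B) ⊆ A`. The universe of the test spaces `Z` is the first parameter. -/
def IsGANRPair (G : Type v) {X : Type u} [Group G] [TopologicalSpace G]
    [TopologicalSpace X] [TopologicalSpace.MetrizableSpace X]
    [MulAction G X] [ContinuousSMul G X] (A : SubMulAction G X) : Prop :=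
  ∀ (Z : Type w) [TopologicalSpace Z] [TopologicalSpace.MetrizableSpace Z]
    [MulAction G Z] [ContinuousSMul G Z] (B : SubMulAction G Z), IsClosed (B : Set Z) →
    ∀ f : B →[G] X, Continuous f →
      ∃ U : SubMulAction G Z, (U : Set Z) ∈ 𝓝ˢ (B : Set Z) ∧
        ∃ F : U →[G] X, Continuous F ∧
          (∀ (u : U) (hu : (u : Z) ∈ B), F u = f ⟨u, hu⟩) ∧
          (∀ u : U, (u : Z) ∉ B → F u ∈ A)

/-- `(X, A)` is a `G`-AR-pair: as for `G`-ANR-pairs, but the extension exists on all of `Z`. -/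
def IsGARPair (G : Type v) {X : Type u} [Group G] [TopologicalSpace G]
    [TopologicalSpace X] [TopologicalSpace.MetrizableSpace X]
    [MulAction G X] [ContinuousSMul G X] (A : SubMulAction G X) : Prop :=
  ∀ (Z : Type w) [TopologicalSpace Z] [TopologicalSpace.MetrizableSpace Z]
    [MulAction G Z] [ContinuousSMul G Z] (B : SubMulAction G Z), IsClosed (B : Set Z) →
    ∀ f : B →[G] X, Continuous f →
      ∃ F : Z →[G] X, Continuous F ∧
        (∀ (z : Z) (hz : z ∈ B), F z = f ⟨z, hz⟩) ∧
        (∀ z : Z, z ∉ B → F z ∈ A)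

/-- A `G`-space `Y` is `G`-contractible: there is a `G`-homotopy `F : Y × I → Y` (equivariant for
the diagonal action `g • (y, t) = (g • y, t)`) from the identity to a map that is constant, with
value some point `c` of `Y`. In particular the empty `G`-space is not `G`-contractible. -/
def GContractible (G Y : Type*) [Group G] [TopologicalSpace Y] [MulAction G Y] : Prop :=
  ∃ F : C(Y × I, Y), (∀ (g : G) (y : Y) (t : I), F (g • y, t) = g • F (y, t)) ∧
    (∀ y : Y, F (y, 0) = y) ∧ ∃ c : Y, ∀ y : Y, F (y, 1) = c

/-! If `(X, A)` is a `G`-AR-pair, extending the empty map over a point gives a fixed point `c ∈ A`.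
Extending over `A × I` the map that is the inclusion at time `0` and `c` at time `1` then contracts
`A`. Conversely, a local extension `F` on `U` takes values in `A` off `B`, so it can be pushed along
the contraction as an invariant Urysohn function grows, reaching the constant `c` before `U` is
left. -/

/-- A closed invariant set `B` and a neighbourhood `U` of it in a `G`-space with `G` compact are
separated by a `G`-invariant Urysohn function. -/
theorem exists_invariant_urysohn {G : Type*} [Group G] [TopologicalSpace G] [CompactSpace G]
    {Z : Type*} [TopologicalSpace Z] [NormalSpace Z] [MulAction G Z] [ContinuousSMul G Z]
    (B : SubMulAction G Z) (hB : IsClosed (B : Set Z)) {U : Set Z} (hU : U ∈ 𝓝ˢ (B : Set Z)) :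
    ∃ l : Z → ℝ, Continuous l ∧ (∀ (g : G) (z : Z), l (g • z) = l z) ∧
      (∀ z ∈ B, l z = 0) ∧ ∀ z, l z < 1 → z ∈ U := by
  obtain ⟨p, hp0, hp1, hpI⟩ := exists_continuous_zero_one_of_isClosed hB
    (isOpen_interior (s := U)).isClosed_compl
    (Set.disjoint_compl_right_iff_subset.2 (subset_interior_iff_mem_nhdsSet.2 hU))
  -- The supremum over the orbit is invariant; compactness of `G` makes it continuous.
  refine ⟨fun z => sSup ((fun g : G => p (g • z)) '' Set.univ), ?_, ?_, ?_, ?_⟩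
  · exact isCompact_univ.continuous_sSup (f := fun (z : Z) (g : G) => p (g • z))
      (p.continuous.comp (continuous_snd.smul continuous_fst))
  · intro g z
    refine congrArg sSup (Set.ext fun r => ?_)
    simp only [Set.image_univ, Set.mem_range, smul_smul]
    exact (Equiv.mulRight g).exists_congr_left.trans (by simp)
  · intro z hz
    have : (fun g : G => p (g • z)) = fun _ => 0 := funext fun g => hp0 (B.smul_mem g hz)
    simp [this]
  · intro z hz
    by_contra hzU
    refine hz.not_ge (le_csSup ⟨1, ?_⟩ ⟨1, Set.mem_univ _, ?_⟩)
    · rintro _ ⟨g, -, rfl⟩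
      exact (hpI _).2
    · simpa using hp1 (x := z) fun h => hzU (interior_subset h)

/-- The second member of a `G`-AR-pair contains a fixed point. -/
theorem IsGARPair.exists_fixedPoint {G : Type v} [Group G] [TopologicalSpace G]
    {X : Type u} [TopologicalSpace X] [TopologicalSpace.MetrizableSpace X]
    [MulAction G X] [ContinuousSMul G X] {A : SubMulAction G X} (h : IsGARPair.{w} G A) :
    ∃ c : A, ∀ g : G, g • c = c := by
  let : MulAction G PUnit.{w + 1} :=
    { smul := fun _ z => z, one_smul := fun _ => rfl, mul_smul := fun _ _ _ => rfl }
  have : ContinuousSMul G PUnit.{w + 1} := ⟨continuous_const⟩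
  let f : (⊥ : SubMulAction G PUnit.{w + 1}) →[G] X :=
    { toFun := fun z => z.2.elim, map_smul' := fun _ z => z.2.elim }
  obtain ⟨F, -, -, hFA⟩ := h PUnit.{w + 1} ⊥ isClosed_empty f
    (continuous_iff_continuousAt.2 fun z => z.2.elim)
  refine ⟨⟨F ⟨⟩, hFA ⟨⟩ fun h => h.elim⟩, fun g => Subtype.ext ?_⟩
  exact (map_smul F g PUnit.unit).symm

theorem IsGARPair.gContractible {G : Type v} [Group G] [TopologicalSpace G]
    {X : Type u} [TopologicalSpace X] [TopologicalSpace.MetrizableSpace X]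
    [MulAction G X] [ContinuousSMul G X] {A : SubMulAction G X}
    (h : IsGARPair.{max u w} G A) : GContractible G A := by
  classical
  obtain ⟨c, hc⟩ := h.exists_fixedPoint
  -- The lift only moves `A × I` into the universe of the test spaces.
  let Z := ULift.{w} (A × I)
  let : MulAction G Z :=
    { smul := fun g z => ⟨(g • z.down.1, z.down.2)⟩
      one_smul := fun z => ULift.ext _ _ (Prod.ext (one_smul G z.down.1) rfl)
      mul_smul := fun g k z => ULift.ext _ _ (Prod.ext (mul_smul g k z.down.1) rfl) }
  have : ContinuousSMul G Z := ⟨continuous_uliftUp.comp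
    ((continuous_fst.smul (continuous_fst.comp (continuous_uliftDown.comp continuous_snd))).prodMk
      (continuous_snd.comp (continuous_uliftDown.comp continuous_snd)))⟩
  have : TopologicalSpace.MetrizableSpace A := IsEmbedding.subtypeVal.metrizableSpace
  have : TopologicalSpace.MetrizableSpace Z :=
    Homeomorph.ulift.isEmbedding.metrizableSpace
  let τ : Z → I := fun z => z.down.2
  have hτ : Continuous τ := continuous_snd.comp continuous_uliftDown
  let B : SubMulAction G Z :=
    { carrier := τ ⁻¹' {0, 1}
      smul_mem' := fun _ _ hz => hz }
  have hB : IsClosed (B : Set Z) := ((Set.toFinite {0, 1}).isClosed).preimage hτ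
  let f : B →[G] X :=
    { toFun := fun z => if τ z = 0 then (z : Z).down.1 else (c : X)
      map_smul' := fun g z => by
        change (if τ z = 0 then ((g • (z : Z).down.1 : A) : X) else c) =
          g • (if τ z = 0 then ((z : Z).down.1 : X) else c)
        split_ifs
        · rfl
        · exact (congrArg Subtype.val (hc g)).symm }
  have hf : Continuous f := by
    -- On `B` the time is only `0` or `1`, so the two pieces of `f` are clopen and glue freely.
    have hclopen : IsClopen {z : B | τ z = 0} := by
      refine ⟨isClosed_eq (hτ.comp continuous_subtype_val) continuous_const, ?_⟩
      have : {z : B | τ z = 0} = {z : B | τ z ≠ 1} := by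
        ext z
        rcases z.2 with h0 | h1
        · simp [show τ z = 0 from h0]
        · simp [show τ z = 1 from h1]
      rw [this]
      exact isOpen_ne_fun (hτ.comp continuous_subtype_val) continuous_const
    refine Continuous.if (p := fun z : B => τ z = 0) ?_ ?_ continuous_const
    · intro z hz
      simp [hclopen.frontier_eq] at hz
    · exact continuous_subtype_val.comp
        (continuous_fst.comp (continuous_uliftDown.comp continuous_subtype_val))
  obtain ⟨F, hF, hFB, hFA⟩ := h Z B hB f hf
  have hmem : ∀ z, F z ∈ A := by
    intro z
    by_cases hz : z ∈ B
    · rw [hFB z hz]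
      change (if τ z = 0 then (z.down.1 : X) else c) ∈ A
      split_ifs
      exacts [z.down.1.2, c.2]
    · exact hFA z hz
  refine ⟨⟨fun q => ⟨F ⟨q⟩, hmem _⟩, (hF.comp continuous_uliftUp).subtype_mk _⟩, ?_, ?_, c, ?_⟩
  · intro g y t
    exact Subtype.ext (map_smul F g (⟨(y, t)⟩ : Z))
  · intro y
    exact Subtype.ext ((hFB ⟨(y, 0)⟩ (Or.inl rfl)).trans (if_pos rfl))
  · intro y
    exact Subtype.ext ((hFB ⟨(y, 1)⟩ (Or.inr rfl)).trans (if_neg one_ne_zero))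

theorem IsGANRPair.isGARPair_of_gContractible {G : Type v} [Group G] [TopologicalSpace G]
    [CompactSpace G] {X : Type u} [TopologicalSpace X] [TopologicalSpace.MetrizableSpace X]
    [MulAction G X] [ContinuousSMul G X] {A : SubMulAction G X}
    (h : IsGANRPair.{w} G A) (hA : GContractible G A) : IsGARPair.{w} G A := by
  classical
  obtain ⟨H, hHsmul, hH0, c, hH1⟩ := hA
  intro Z _ _ _ _ B hB f hf
  obtain ⟨U, hU, F, hF, hFB, hFA⟩ := h Z B hB f hf
  obtain ⟨l, hl, hlsmul, hlB, hlU⟩ := exists_invariant_urysohn B hB hU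
  -- The time-one map is equivariant and constant, so its value is fixed.
  have hc : ∀ g : G, g • c = c := fun g => by rw [← hH1 c, ← hHsmul, hH1]; exact (hH1 c).symm
  -- the time parameter: `0` where `l ≤ 1/3`, and `1` where `2/3 ≤ l`
  let t : Z → I := fun z => Set.projIcc 0 1 zero_le_one (3 * l z - 1)
  have ht : Continuous t := continuous_projIcc.comp ((continuous_const.mul hl).sub continuous_const)
  have ht0 : ∀ z, l z < 1 / 3 → t z = 0 := fun z hz =>
    Set.projIcc_of_le_left _ (by linarith)
  have ht1 : ∀ z, 2 / 3 < l z → t z = 1 := fun z hz =>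
    Set.projIcc_of_right_le _ (by linarith)
  -- Points of `B` need their own case: there `F` may leave `A`, where `H` is undefined.
  let E : Z → X := fun z =>
    if hz : l z < 1 then
      if hzB : z ∈ B then F ⟨z, hlU z hz⟩
      else H (⟨F ⟨z, hlU z hz⟩, hFA ⟨z, hlU z hz⟩ hzB⟩, t z)
    else c
  have hEB : ∀ z (hz : l z < 1), z ∈ B → E z = F ⟨z, hlU z hz⟩ := fun z hz hzB => by
    simp only [E, dif_pos hz, dif_pos hzB]
  have hEH : ∀ z (hz : l z < 1) (hzB : z ∉ B),
      E z = H (⟨F ⟨z, hlU z hz⟩, hFA ⟨z, hlU z hz⟩ hzB⟩, t z) := fun z hz hzB => by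
    simp only [E, dif_pos hz, dif_neg hzB]
  have hEc : ∀ z, ¬ l z < 1 → E z = c := fun z hz => by simp only [E, dif_neg hz]
  have hElow : ∀ z (hz : l z < 1 / 3), E z = F ⟨z, hlU z (by linarith)⟩ := fun z hz => by
    by_cases hzB : z ∈ B
    · exact hEB z (by linarith) hzB
    · rw [hEH z (by linarith) hzB, ht0 z hz, hH0]
  have hEhigh : ∀ z, 2 / 3 < l z → E z = c := fun z hz => by
    by_cases hz1 : l z < 1
    · rw [hEH z hz1 fun hzB => by linarith [hlB z hzB], ht1 z hz, hH1]
    · exact hEc z hz1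
  have hEcont : Continuous E := by
    refine continuous_iff_continuousAt.2 fun z => ?_
    have hop : ∀ a, IsOpen {z | l z < a} := fun a => isOpen_lt hl continuous_const
    have hop' : ∀ a, IsOpen {z | a < l z} := fun a => isOpen_lt continuous_const hl
    -- Three open sets cover `Z`: `E` is `F` where `l < 1/3`, constant where `l > 2/3`, and given by
    -- `H` where `0 < l < 1`, a region that misses `B`.
    rcases lt_or_ge (l z) (1 / 3) with hlow | hlow
    · refine ContinuousOn.continuousAt ?_ ((hop (1 / 3)).mem_nhds hlow)
      rw [continuousOn_iff_continuous_domRestrict]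
      exact (hF.comp (continuous_subtype_val.subtype_mk fun y : {z | l z < 1 / 3} =>
        hlU y (by linarith [y.2.out]))).congr fun y => (hElow y y.2).symm
    rcases lt_or_ge (2 / 3) (l z) with hhigh | hhigh
    · refine ContinuousOn.continuousAt ?_ ((hop' (2 / 3)).mem_nhds hhigh)
      exact continuousOn_const.congr fun y hy => hEhigh y hy
    · refine ContinuousOn.continuousAt (s := {z | 0 < l z} ∩ {z | l z < 1}) ?_
        (((hop' 0).inter (hop 1)).mem_nhds
          ⟨show 0 < l z by linarith, show l z < 1 by linarith⟩)
      rw [continuousOn_iff_continuous_domRestrict]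
      have hnB : ∀ y : ↥({z | 0 < l z} ∩ {z | l z < 1}), (y : Z) ∉ B :=
        fun y hy => y.2.1.out.ne' (hlB y hy)
      exact (continuous_subtype_val.comp (H.continuous.comp
        (((hF.comp (continuous_subtype_val.subtype_mk fun y => hlU y y.2.2)).subtype_mk
          fun y => hFA _ (hnB y)).prodMk (ht.comp continuous_subtype_val)))).congr
        fun y => (hEH y y.2.2 (hnB y)).symm
  have hEsmul : ∀ (g : G) z, E (g • z) = g • E z := by
    intro g z
    by_cases hz : l z < 1
    · have hgz : l (g • z) < 1 := by rwa [hlsmul]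
      have hFg : F ⟨g • z, hlU _ hgz⟩ = g • F ⟨z, hlU z hz⟩ := map_smul F g ⟨z, hlU z hz⟩
      by_cases hzB : z ∈ B
      · rw [hEB z hz hzB, hEB _ hgz (B.smul_mem g hzB), hFg]
      · have hgzB : g • z ∉ B := fun hgB => hzB (by simpa using B.smul_mem g⁻¹ hgB)
        have htg : t (g • z) = t z := by simp only [t, hlsmul]
        rw [hEH z hz hzB, hEH _ hgz hgzB, htg, ← SubMulAction.val_smul, ← hHsmul]
        congr 3
        exact Subtype.ext hFg
    · rw [hEc z hz, hEc _ (by rwa [hlsmul]), ← SubMulAction.val_smul, hc]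
  refine ⟨⟨E, hEsmul⟩, hEcont, fun z hz => ?_, fun z hz => ?_⟩
  · have hz1 : l z < 1 := by rw [hlB z hz]; exact one_pos
    exact (hEB z hz1 hz).trans (hFB ⟨z, hlU z hz1⟩ hz)
  · change E z ∈ A
    by_cases hz1 : l z < 1
    · rw [hEH z hz1 hz]
      exact Subtype.property _
    · rw [hEc z hz1]
      exact c.2

theorem proposition3p4 (G : Type v) [Group G] [TopologicalSpace G]
    [IsTopologicalGroup G] [T2Space G] [CompactSpace G]
    (X : Type u) [TopologicalSpace X] [TopologicalSpace.MetrizableSpace X]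
    [MulAction G X] [ContinuousSMul G X] (A : SubMulAction G X)
    (hXA : IsGANRPair.{max u w} G A) :
    IsGARPair.{max u w} G A ↔ GContractible G A :=
  ⟨fun h => IsGARPair.gContractible.{w} h, fun h => hXA.isGARPair_of_gContractible h⟩
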